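/- Theorem. Let $n\ge 0$. For a real $n\times n$ matrix $X$ and $I,J\subseteq[n]=\{1,\dots,n\}$ with $|I|=|J|$, let $X_I^J$ be the minor with rows $I$ and columns $J$, all indices taken in increasing order, and put $$p_I=(-1)^{\lfloor |I|/2\rfloor}X_I^I,\qquad a_{ij|I}=(-1)^{\lceil |I|/2\rceil}X_{\{i\}\cup I}^{\{j\}\cup I}\quad(i\neq j,\ i,j\notin I),$$ so that $p_\emptyset=1$. Let $\mathcal E_n$ be the set of $n\times n$ correlation matrices, that is, real symmetric positive definite matrices $Y=(y_{ij})$ with all $y_{ii}=1$. The connected partial correlations of $Y\in\mathcal E_n$ are the $\binom n2$ numbers $$\rho_{ij|I}=\frac{(-1)^{\lceil |I|/2\rceil}\,a_{ij|I}}{\sqrt{p_{\{i\}\cup I}\;p_{\{j\}\cup I}}},\qquad 1\le i<j\le n,\quad I=\{i+1,\dots,j-1\}.$$ Catalan path formula. For $1\le l<r\le n$ label the lattice point $(l+r-2,\,r-l)$ by $a_{lr|\{l+1,\dots,r-1\}}$ and the region just below it by $p_{\{l+1,\dots,r-1\}}$; thus the region just above $(l+r-2,r-l)$, $l\le r$,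 is labelled $p_{\{l,\dots,r\}}$. Node $l$ is the point $(2l-2,0)$; it carries no label $a$. A Catalan path $C$ from node $i$ to node $j$ is a path with steps $(1,1)$ and $(1,-1)$ from node $i$ to node $j$ that never goes below the horizontal axis. Its weight $W(C)$ is the product of the labels $a$ of all its local maxima and interior local minima above the axis, divided by the product of the labels $p$ of the regions just below a local maximum or just above an interior local minimum. For real numbers $\rho=(\rho_{ij|I})$ in the open cube $(-1,1)^{\binom n2}$, define a symmetric matrix $\Psi(\rho)=(y_{ij})$ with $y_{ii}=1$ as follows. For $i<j$, let $y_{ij}=\sum_C W(C)$, the sum over all Catalan paths $C$ from node $i$ to node $j$, in which first each $a_{ij|I}$ is replaced by $(-1)^{\lceil |I|/2\rceil}\rho_{ij|I}\sqrt{p_{\{i\}\cup I}\,p_{\{j\}\cup I}}$, and then each $p_{\{r,\dots,s\}}$ (also inside the square roots) is replaced by $$(-1)^{\lfloor (s-r+1)/2\rfloor}\prod_{r\le i<j\le s}\bigl(1-\rho_{ij|\{i+1,\dots,j-1\}}^2\bigr).$$ Then: 1. $\Psi$ is a bijection from $(-1,1)^{\binom n2}$ onto $\mathcal E_n$, and each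 entry of $\Psi$ is an algebraic function on the cube, i.e. it satisfies a nonzero polynomial equation in one unknown with coefficients in the polynomial ring $\mathbb R[\rho_{ij|I}]$. 2. The entries of a correlation matrix are written uniquely in terms of its connected partial correlations by $\Psi$. That is, for each $Y\in\mathcal E_n$ the vector $\rho(Y)$ of connected partial correlations of $Y$ lies in the open cube, $\Psi(\rho(Y))=Y$, and $\rho(Y)$ is the only point of the cube mapped to $Y$. Conversely $\rho(\Psi(\rho))=\rho$ for every $\rho$ in the cube. Moreover, any function $F$ of the $\binom n2$ parameters with $F(\rho(Y))=Y$ for all $Y\in\mathcal E_n$ equals $\Psi$ on the cube. 3. For each $Y\in\mathcal E_n$ the expressions above that replace the connected $a_{ij|I}$ and $p_{\{r,\dots,s\}}$, evaluated at $\rho=\rho(Y)$, are equal to the corresponding minors of $Y$. -/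

import Mathlib

/-- The minor `X_I^J` with rows `I` and columns `J`, both taken in increasing order
(only meaningful for `|I| = |J|`). -/
def sortedMinor {R : Type*} [CommRing R] {n : ℕ} (X : Matrix (Fin n) (Fin n) R)
    (I J : Finset (Fin n)) : R :=
  if h : J.card = I.card then
    (X.submatrix (I.orderEmbOfFin rfl) (J.orderEmbOfFin h)).det
  else 0

/-- The signed principal minor `p_I = (-1)^⌊|I|/2⌋ X_I^I`. -/
def principalMinor {R : Type*} [CommRing R] {n : ℕ} (X : Matrix (Fin n) (Fin n) R)
    (I : Finset (Fin n)) : R :=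
  (-1) ^ (I.card / 2) * sortedMinor X I I

/-- The signed almost-principal minor `a_{ij|I} = (-1)^⌈|I|/2⌉ X_{iI}^{jI}`
(for `i ≠ j` and `i, j ∉ I`). -/
def almostPrincipalMinor {R : Type*} [CommRing R] {n : ℕ} (X : Matrix (Fin n) (Fin n) R)
    (i j : Fin n) (I : Finset (Fin n)) : R :=
  (-1) ^ ((I.card + 1) / 2) * sortedMinor X (insert i I) (insert j I)

/-- The partial correlation `ρ_{ij|I} = (-1)^⌈|I|/2⌉ a_{ij|I} / √(p_{iI} p_{jI})`
(for `i < j` and `i, j ∉ I`). -/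
noncomputable def partialCorrelation {n : ℕ} (X : Matrix (Fin n) (Fin n) ℝ)
    (i j : Fin n) (I : Finset (Fin n)) : ℝ :=
  (-1) ^ ((I.card + 1) / 2) * almostPrincipalMinor X i j I /
    Real.sqrt (principalMinor X (insert i I) * principalMinor X (insert j I))

/-- The index set of the connected partial correlations: pairs `i < j`. -/
abbrev IndexPair (n : ℕ) : Type := {e : Fin n × Fin n // e.1 < e.2}

/-- The connected partial correlations `ρ_{ij|I}`, `I = {i+1, …, j-1}`, of a matrix. -/
noncomputable def connectedCorrelations {n : ℕ} (X : Matrix (Fin n) (Fin n) ℝ) :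
    IndexPair n → ℝ :=
  fun e => partialCorrelation X e.1.1 e.1.2 (Finset.Ioo e.1.1 e.1.2)

/-- The set of `n × n` correlation matrices (the open elliptope): real symmetric positive
definite matrices with unit diagonal. -/
def openElliptope (n : ℕ) : Set (Matrix (Fin n) (Fin n) ℝ) :=
  {Y | Y.PosDef ∧ ∀ i, Y i i = 1}

/-- The open cube `(-1,1)^(n choose 2)`. -/
def openCube (n : ℕ) : Set (IndexPair n → ℝ) :=
  {ρ | ∀ e, ρ e ∈ Set.Ioo (-1 : ℝ) 1}

/-- The weight of a lattice path that starts at the node `(l, r)` with the given steps.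
Here `(l, r)`, `l ≤ r`, stands for the lattice point `(l + r, r - l)`, up to a translation along
the horizontal axis; so a northeast step `U` increases `r`, a southeast step `D` increases `l`, and
`(l, l)` is the node `l` on the horizontal axis.  A node with `l < r` is labelled
`a l r = a_{lr|{l+1,…,r-1}}`, the region just below it is labelled `p {l+1,…,r-1}`, and hence the
region just above a node `(l, r)` with `l ≤ r` is labelled `p {l,…,r}`.

Each local maximum contributes its label divided by the label of the region just below it.
Each (interior) local minimum contributes its label divided by the label of the region just above
it, where a local minimum on the horizontal axis carries no label `a`. -/
def pathWeight {K : Type*} [Field K] (a : ℕ → ℕ → K) (p : Finset ℕ → K) :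
    ℕ → ℕ → List DyckStep → K
  | l, r, .U :: .D :: t =>
      a l (r + 1) / p (Finset.Ioo l (r + 1)) * pathWeight a p l (r + 1) (.D :: t)
  | l, r, .D :: .U :: t =>
      (if l + 1 = r then 1 else a (l + 1) r) / p (Finset.Icc (l + 1) r) *
        pathWeight a p (l + 1) r (.U :: t)
  | l, r, .U :: t => pathWeight a p l (r + 1) t
  | l, r, .D :: t => pathWeight a p (l + 1) r t
  | _, _, [] => 1

/-- The sum of the weights of all Catalan paths from node `i` to node `j`, for `i ≤ j`. -/
noncomputable def catalanSum {K : Type*} [Field K] (a : ℕ → ℕ → K) (p : Finset ℕ → K)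
    (i j : ℕ) : K :=
  ∑ w : {w : DyckWord // w.semilength = j - i}, pathWeight a p i i w.1.toList

/-- The parameter `ρ_{ij|{i+1,…,j-1}}`, for natural numbers `i < j < n` (and `0` for all other
`i`, `j`, which never occur). -/
noncomputable def param {n : ℕ} (ρ : IndexPair n → ℝ) (i j : ℕ) : ℝ :=
  if h : i < j ∧ j < n then ρ ⟨(⟨i, h.1.trans h.2⟩, ⟨j, h.2⟩), h.1⟩ else 0

/-- The expression that replaces `p_I`, for an interval `I = {r,…,s}`: it is `(-1)^⌊|I|/2⌋` times
the product of all `1 - ρ_{ij|{i+1,…,j-1}}²` over `r ≤ i < j ≤ s`. -/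
noncomputable def replacedP {n : ℕ} (ρ : IndexPair n → ℝ) (I : Finset ℕ) : ℝ :=
  (-1) ^ (I.card / 2) *
    ∏ e ∈ (I ×ˢ I).filter (fun e : ℕ × ℕ => e.1 < e.2), (1 - param ρ e.1 e.2 ^ 2)

/-- The expression that replaces `a_{ij|I}`, `I = {i+1,…,j-1}`:
`(-1)^⌈|I|/2⌉ ρ_{ij|I} √(p_{iI} p_{jI})`, with `p_{iI}` and `p_{jI}` replaced as above. -/
noncomputable def replacedA {n : ℕ} (ρ : IndexPair n → ℝ) (i j : ℕ) : ℝ :=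
  (-1) ^ (((Finset.Ioo i j).card + 1) / 2) * param ρ i j *
    Real.sqrt (replacedP ρ (Finset.Ico i j) * replacedP ρ (Finset.Ioc i j))

/-- The map `Ψ` from the connected partial correlations to the entries of the correlation matrix:
the Catalan path formula with all parameters replaced. -/
noncomputable def correlationMap (n : ℕ) (ρ : IndexPair n → ℝ) : Matrix (Fin n) (Fin n) ℝ :=
  Matrix.of fun i j =>
    if i = j then 1
    else catalanSum (replacedA ρ) (replacedP ρ) (min (i : ℕ) (j : ℕ)) (max (i : ℕ) (j : ℕ))

/-! A correlation matrix is the Gram matrix of independent unit vectors `v 0, …, v (n - 1)`. For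
each block of consecutive indices, let L and R be the residuals of its first and last vector after
projection off the rest of the block. They obey a two-term recursion in the block length, and
consecutive Gram determinants factor through them (`gramDet_succ_right`, `gramDet_succ_left`,
`gramDet_succ_offDiag`). So a connected partial correlation is, up to the sign `(-1)^|I|`, the
cosine between the residuals L and R of its two ends with respect to I. By Pythagoras, squared norms
of residuals are products of factors 1 - ρ², which gives the replacement rules for p and a.

The path formula is this recursion unrolled. Write R̂ for R divided by its squared norm. Then L of
order h is L of order h + 1 plus (weight of a maximum) times R̂; and R̂ of order h + 1 is (weight of
a minimum) times L of order h + 1 plus R̂ of order h. A path about to rise thus carries L, and one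
about to descend carries R̂. Pairing with `v j` and inducting on the remaining steps
(`sum_pathWeight_eq_inner`), the paths from node i sum to ⟨v i, v j⟩, so Ψ(ρ(Y)) = Y.

It remains that ρ maps onto the cube: the recursion is a plane rotation after normalization, so it
can be run backwards from arbitrary prescribed cosines (`residual_eq_smul_frame`). Algebraicity
holds because algebraic functions form a ring, which contains the needed inverses and square roots.
-/

/-! ### Orthogonal residuals and their recursion -/

section LatticeResiduals

variable {E : Type*} [NormedAddCommGroup E] [InnerProductSpace ℝ E]

open scoped InnerProductSpace

/-- The pair of residuals of order `m` of a sequence of vectors, computed by the lattice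
(Levinson) recursion: the residual of `v l` with respect to `v (l + 1), …, v (l + m)`, and the
residual of `v (l + m)` with respect to `v l, …, v (l + m - 1)`. -/
noncomputable def latticeResiduals (v : ℕ → E) : ℕ → ℕ → E × E
  | 0, l => (v l, v l)
  | m + 1, l =>
    let x := (latticeResiduals v m l).1
    let y := (latticeResiduals v m (l + 1)).2
    (x - (⟪x, y⟫_ℝ / ⟪y, y⟫_ℝ) • y, y - (⟪x, y⟫_ℝ / ⟪x, x⟫_ℝ) • x)

/-- The residual of `v l` with respect to `v (l + 1), …, v (l + m)`. -/
noncomputable def leftResidual (v : ℕ → E) (m l : ℕ) : E := (latticeResiduals v m l).1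

/-- The residual of `v (l + m)` with respect to `v l, …, v (l + m - 1)`. -/
noncomputable def rightResidual (v : ℕ → E) (m l : ℕ) : E := (latticeResiduals v m l).2

variable (v : ℕ → E)

@[simp] lemma leftResidual_zero (l : ℕ) : leftResidual v 0 l = v l := rfl

@[simp] lemma rightResidual_zero (l : ℕ) : rightResidual v 0 l = v l := rfl

lemma leftResidual_succ (m l : ℕ) :
    leftResidual v (m + 1) l = leftResidual v m l -
      (⟪leftResidual v m l, rightResidual v m (l + 1)⟫_ℝ /
        ⟪rightResidual v m (l + 1), rightResidual v m (l + 1)⟫_ℝ) •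
          rightResidual v m (l + 1) := rfl

lemma rightResidual_succ (m l : ℕ) :
    rightResidual v (m + 1) l = rightResidual v m (l + 1) -
      (⟪leftResidual v m l, rightResidual v m (l + 1)⟫_ℝ /
        ⟪leftResidual v m l, leftResidual v m l⟫_ℝ) • leftResidual v m l := rfl

/-- With `inner_residual_eq_zero`, this identifies the recursively defined vectors as residuals of
orthogonal projections. -/
lemma residual_sub_mem_span (m l : ℕ) :
    leftResidual v m l - v l ∈ Submodule.span ℝ (v '' Set.Ioc l (l + m)) ∧
      rightResidual v m l - v (l + m) ∈ Submodule.span ℝ (v '' Set.Ico l (l + m)) := by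
  induction m generalizing l with
  | zero => simp
  | succ m ih =>
    have hL : ∀ s : Set ℕ, Set.Icc l (l + m) ⊆ s →
        leftResidual v m l ∈ Submodule.span ℝ (v '' s) := fun s hs => by
      rw [← sub_add_cancel (leftResidual v m l) (v l)]
      refine add_mem (Submodule.span_mono (Set.image_mono (fun x hx => hs ?_)) (ih l).1)
        (Submodule.subset_span ⟨l, hs ?_, rfl⟩)
      · exact ⟨hx.1.le, hx.2⟩
      · simp
    have hR : ∀ s : Set ℕ, Set.Icc (l + 1) (l + 1 + m) ⊆ s →
        rightResidual v m (l + 1) ∈ Submodule.span ℝ (v '' s) := fun s hs => by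
      rw [← sub_add_cancel (rightResidual v m (l + 1)) (v (l + 1 + m))]
      refine add_mem (Submodule.span_mono (Set.image_mono (fun x hx => hs ?_)) (ih (l + 1)).2)
        (Submodule.subset_span ⟨l + 1 + m, hs ?_, rfl⟩)
      · exact ⟨hx.1, hx.2.le⟩
      · simp
    constructor
    · rw [leftResidual_succ, sub_right_comm]
      refine sub_mem (Submodule.span_mono (Set.image_mono (fun x hx => ?_)) (ih l).1)
        (Submodule.smul_mem _ _ (hR _ fun x hx => ?_))
      all_goals simp only [Set.mem_Ioc, Set.mem_Icc] at *; omega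
    · rw [rightResidual_succ, sub_right_comm, show l + (m + 1) = l + 1 + m by ring]
      refine sub_mem (Submodule.span_mono (Set.image_mono (fun x hx => ?_)) (ih (l + 1)).2)
        (Submodule.smul_mem _ _ (hL _ fun x hx => ?_))
      all_goals simp only [Set.mem_Ico, Set.mem_Icc] at *; omega

lemma inner_eq_zero_of_mem_span_image {s : Set ℕ} {x y : E} (hy : y ∈ Submodule.span ℝ (v '' s))
    (h : ∀ k ∈ s, ⟪x, v k⟫_ℝ = 0) : ⟪x, y⟫_ℝ = 0 := by
  induction hy using Submodule.span_induction with
  | mem y hy => obtain ⟨k, hk, rfl⟩ := hy; exact h k hk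
  | zero => simp
  | add y z _ _ hy hz => rw [inner_add_right, hy, hz, add_zero]
  | smul c y _ hy => rw [inner_smul_right, hy, mul_zero]

lemma inner_self_of_sub_mem_span_image {s : Set ℕ} {x y : E}
    (hy : y - x ∈ Submodule.span ℝ (v '' s)) {z : E}
    (h : ∀ k ∈ s, ⟪z, v k⟫_ℝ = 0) : ⟪z, y⟫_ℝ = ⟪z, x⟫_ℝ := by
  rw [← sub_eq_zero, ← inner_sub_right]
  exact inner_eq_zero_of_mem_span_image v hy h

lemma inner_sub_smul_right_self (x y : E) : ⟪x - (⟪x, y⟫_ℝ / ⟪y, y⟫_ℝ) • y, y⟫_ℝ = 0 := by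
  by_cases hy : y = 0
  · simp [hy]
  · rw [inner_sub_left, real_inner_smul_left,
      div_mul_cancel₀ _ (inner_self_ne_zero (𝕜 := ℝ).2 hy), sub_self]

/-- Both residuals of the previous order are orthogonal to the interior vectors, hence so is their
combination. At the one new index, the vector may be replaced by its own residual, which the
subtracted projection makes orthogonal. -/
lemma inner_residual_eq_zero (m l : ℕ) :
    (∀ k ∈ Set.Ioc l (l + m), ⟪leftResidual v m l, v k⟫_ℝ = 0) ∧
      ∀ k ∈ Set.Ico l (l + m), ⟪rightResidual v m l, v k⟫_ℝ = 0 := by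
  induction m generalizing l with
  | zero => simp
  | succ m ih =>
    have hL : ∀ k ∈ Set.Ico (l + 1) (l + 1 + m), ⟪leftResidual v m l, v k⟫_ℝ = 0 :=
      fun k hk => (ih l).1 k (by simp only [Set.mem_Ioc, Set.mem_Ico] at *; omega)
    have hR : ∀ k ∈ Set.Ioc l (l + m), ⟪rightResidual v m (l + 1), v k⟫_ℝ = 0 :=
      fun k hk => (ih (l + 1)).2 k (by simp only [Set.mem_Ioc, Set.mem_Ico] at *; omega)
    have h1 : ∀ k ∈ Set.Ico (l + 1) (l + 1 + m), ⟪leftResidual v (m + 1) l, v k⟫_ℝ = 0 := by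
      intro k hk
      rw [leftResidual_succ, inner_sub_left, real_inner_smul_left, hL k hk,
        (ih (l + 1)).2 k hk]
      simp
    have h2 : ∀ k ∈ Set.Ioc l (l + m), ⟪rightResidual v (m + 1) l, v k⟫_ℝ = 0 := by
      intro k hk
      rw [rightResidual_succ, inner_sub_left, real_inner_smul_left, hR k hk, (ih l).1 k hk]
      simp
    constructor
    · intro k hk
      by_cases hkm : k = l + 1 + m
      · rw [hkm, ← inner_self_of_sub_mem_span_image v (residual_sub_mem_span v m (l + 1)).2 h1,
          leftResidual_succ, inner_sub_smul_right_self]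
      · exact h1 k (by simp only [Set.mem_Ioc, Set.mem_Ico] at *; omega)
    · intro k hk
      by_cases hkm : k = l
      · rw [hkm, ← inner_self_of_sub_mem_span_image v (residual_sub_mem_span v m l).1 h2,
          rightResidual_succ, real_inner_comm (rightResidual v m (l + 1)),
          inner_sub_smul_right_self]
      · exact h2 k (by simp only [Set.mem_Ioc, Set.mem_Ico] at *; omega)

lemma inner_leftResidual_self (m l : ℕ) :
    ⟪leftResidual v m l, leftResidual v m l⟫_ℝ = ⟪leftResidual v m l, v l⟫_ℝ :=
  inner_self_of_sub_mem_span_image v (residual_sub_mem_span v m l).1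
    (inner_residual_eq_zero v m l).1

lemma inner_rightResidual_self (m l : ℕ) :
    ⟪rightResidual v m l, rightResidual v m l⟫_ℝ = ⟪rightResidual v m l, v (l + m)⟫_ℝ :=
  inner_self_of_sub_mem_span_image v (residual_sub_mem_span v m l).2
    (inner_residual_eq_zero v m l).2

lemma inner_leftResidual_rightResidual (m l : ℕ) :
    ⟪leftResidual v m l, rightResidual v m (l + 1)⟫_ℝ =
      ⟪rightResidual v m (l + 1), v l⟫_ℝ := by
  rw [real_inner_comm]
  refine inner_self_of_sub_mem_span_image v (residual_sub_mem_span v m l).1 fun k hk =>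
    (inner_residual_eq_zero v m (l + 1)).2 k ?_
  simp only [Set.mem_Ioc, Set.mem_Ico] at *; omega

/-- The residuals are orthogonal projections of linearly independent vectors, so they do not
vanish. -/
lemma residual_ne_zero {n : ℕ} (h : LinearIndependent ℝ fun i : Fin n => v i) {m l : ℕ}
    (hl : l + m < n) : leftResidual v m l ≠ 0 ∧ rightResidual v m l ≠ 0 := by
  have key : ∀ (s : Set ℕ) (i : ℕ) (_ : i < n) (_ : ∀ k ∈ s, k < n) (_ : i ∉ s) (x : E),
      x - v i ∈ Submodule.span ℝ (v '' s) → x ≠ 0 := by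
    rintro s i hi hs his x hx rfl
    rw [zero_sub, neg_mem_iff] at hx
    have := h.notMem_span_image (s := {k : Fin n | (k : ℕ) ∈ s}) (x := ⟨i, hi⟩) his
    refine this (Submodule.span_mono ?_ hx)
    rintro _ ⟨k, hk, rfl⟩
    exact ⟨⟨k, hs k hk⟩, hk, rfl⟩
  refine ⟨key _ l (by omega) ?_ ?_ _ (residual_sub_mem_span v m l).1,
    key _ (l + m) hl ?_ ?_ _ (residual_sub_mem_span v m l).2⟩
  all_goals simp only [Set.mem_Ioc, Set.mem_Ico]; omega

/-- Nonvanishing of the residuals at `0` forces linear independence. -/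
lemma linearIndependent_of_rightResidual_ne_zero (h : ∀ m, rightResidual v m 0 ≠ 0) :
    LinearIndependent ℝ v := by
  rw [linearIndependent_iff']
  by_contra! hc
  obtain ⟨s, g, hg, i, his, hgi⟩ := hc
  -- In a linear dependence, let `M` be the last index with nonzero coefficient. Pairing with the
  -- right residual of `v M` off all earlier vectors kills every other term.
  set t := s.filter (fun i => g i ≠ 0) with ht
  have hne : t.Nonempty := ⟨i, by simp [ht, his, hgi]⟩
  set M := t.max' hne with hM
  have hMt : M ∈ t := t.max'_mem hne
  have hsum : ∑ i ∈ t, g i • v i = 0 := by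
    rw [← hg, ht]
    exact Finset.sum_filter_of_ne fun x _ hx hgx => hx (by simp [hgx])
  have : ⟪rightResidual v M 0, ∑ i ∈ t, g i • v i⟫_ℝ = g M * ⟪rightResidual v M 0, v M⟫_ℝ := by
    rw [inner_sum, Finset.sum_eq_single_of_mem M hMt, real_inner_smul_right]
    intro k hk hkM
    have := t.le_max' k hk
    rw [real_inner_smul_right, (inner_residual_eq_zero v M 0).2 k (by simp; omega), mul_zero]
  have h2 := inner_rightResidual_self v M 0
  rw [zero_add] at h2
  rw [hsum, inner_zero_right, ← h2, eq_comm, mul_eq_zero, inner_self_eq_zero] at this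
  exact this.elim (Finset.mem_filter.1 hMt).2 (h M)

end LatticeResiduals

/-! ### Gram determinants of consecutive vectors -/

section Determinants

variable {E : Type*} [NormedAddCommGroup E] [InnerProductSpace ℝ E]

open scoped InnerProductSpace

/-- Replacing `w j` by `x` is a column operation; the new column vanishes outside row `i`, so the
Laplace expansion has one term. -/
lemma det_inner_eq {m : ℕ} (u w : Fin (m + 1) → E) (i j : Fin (m + 1)) (x : E)
    (hx : x - w j ∈ Submodule.span ℝ (Set.range fun k => w (j.succAbove k)))
    (h : ∀ k, ⟪u (i.succAbove k), x⟫_ℝ = 0) :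
    (Matrix.of fun a b => ⟪u a, w b⟫_ℝ).det = (-1) ^ (i + j : ℕ) * ⟪u i, x⟫_ℝ *
      (Matrix.of fun a b => ⟪u (i.succAbove a), w (j.succAbove b)⟫_ℝ).det := by
  obtain ⟨c, hc⟩ := (Submodule.mem_span_range_iff_exists_fun ℝ).1 hx
  set A : Matrix (Fin (m + 1)) (Fin (m + 1)) ℝ := Matrix.of fun a b => ⟪u a, w b⟫_ℝ with hA
  have hxc : x = ∑ b, (Fin.insertNth j (1 : ℝ) c : Fin (m + 1) → ℝ) b • w b := by
    rw [Fin.sum_univ_succAbove _ j]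
    simp [hc]
  have hmul : A.mulVec (Fin.insertNth j (1 : ℝ) c) = fun a => ⟪u a, x⟫_ℝ := by
    ext a
    rw [hxc, inner_sum]
    simp only [Matrix.mulVec, dotProduct, hA, Matrix.of_apply, real_inner_smul_right]
    exact Finset.sum_congr rfl fun _ _ => mul_comm _ _
  -- Cramer's rule: putting `A c` in column `j` multiplies the determinant by the entry of `c` at
  -- `j`, here 1.
  have hdet : (A.updateCol j fun a => ⟪u a, x⟫_ℝ).det = A.det := by
    rw [← hmul, ← Matrix.cramer_apply, Matrix.cramer_eq_adjugate_mulVec, Matrix.mulVec_mulVec,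
      Matrix.adjugate_mul, Matrix.smul_mulVec, Matrix.one_mulVec]
    simp
  rw [← hdet, Matrix.det_succ_column _ j, Fin.sum_univ_succAbove _ i, Finset.sum_eq_zero, add_zero]
  · congr 1
    · simp
    · congr 1
      ext a b
      simp [hA]
  · intro k _
    simp [h]

/-- The Gram determinant with rows `l, …, l + m - 1` and columns `r, …, r + m - 1`. -/
noncomputable def gramDet (v : ℕ → E) (l r m : ℕ) : ℝ :=
  (Matrix.of fun a b : Fin m => ⟪v (l + a), v (r + b)⟫_ℝ).det

variable (v : ℕ → E)

lemma gramDet_succ_right (l m : ℕ) :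
    gramDet v l l (m + 1) =
      ⟪rightResidual v m l, rightResidual v m l⟫_ℝ * gramDet v l l m := by
  rw [gramDet, det_inner_eq (fun a : Fin (m + 1) => v (l + a)) (fun a : Fin (m + 1) => v (l + a))
    (Fin.last m) (Fin.last m) (rightResidual v m l)]
  · simp only [Fin.val_last, Fin.succAbove_last, Fin.val_castSucc, gramDet]
    rw [inner_rightResidual_self, real_inner_comm, ← two_mul, pow_mul]
    simp
  · refine Submodule.span_mono ?_ (residual_sub_mem_span v m l).2
    rintro _ ⟨k, hk, rfl⟩
    simp only [Set.mem_Ico] at hk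
    exact ⟨⟨k - l, by omega⟩, by simp; congr 1; omega⟩
  · intro k
    rw [real_inner_comm]
    exact (inner_residual_eq_zero v m l).2 _ (by simp)

lemma gramDet_succ_left (l m : ℕ) :
    gramDet v l l (m + 1) =
      ⟪leftResidual v m l, leftResidual v m l⟫_ℝ * gramDet v (l + 1) (l + 1) m := by
  rw [gramDet, det_inner_eq (fun a : Fin (m + 1) => v (l + a)) (fun a : Fin (m + 1) => v (l + a))
    0 0 (leftResidual v m l)]
  · simp only [Fin.zero_succAbove, Fin.val_succ, gramDet, Fin.val_zero, add_zero]
    rw [inner_leftResidual_self, real_inner_comm]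
    simp [add_assoc, add_comm 1]
  · refine Submodule.span_mono ?_ (residual_sub_mem_span v m l).1
    rintro _ ⟨k, hk, rfl⟩
    simp only [Set.mem_Ioc] at hk
    exact ⟨⟨k - l - 1, by omega⟩, by simp; congr 1; omega⟩
  · intro k
    rw [real_inner_comm]
    exact (inner_residual_eq_zero v m l).1 _ (by simp)

/-- The surviving entry is in the first row and last column, whence the sign; deleting both leaves
the interior principal block. -/
lemma gramDet_succ_offDiag (l m : ℕ) :
    gramDet v l (l + 1) (m + 1) = (-1) ^ m *
      ⟪leftResidual v m l, rightResidual v m (l + 1)⟫_ℝ * gramDet v (l + 1) (l + 1) m := by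
  rw [gramDet, det_inner_eq (fun a : Fin (m + 1) => v (l + a))
    (fun a : Fin (m + 1) => v (l + 1 + a)) 0 (Fin.last m) (rightResidual v m (l + 1))]
  · simp only [Fin.zero_succAbove, Fin.val_succ, gramDet, Fin.val_zero, add_zero,
      Fin.succAbove_last, Fin.val_castSucc, Fin.val_last, zero_add]
    rw [inner_leftResidual_rightResidual, real_inner_comm]
    simp [add_assoc, add_comm 1]
  · refine Submodule.span_mono ?_ (residual_sub_mem_span v m (l + 1)).2
    rintro _ ⟨k, hk, rfl⟩
    simp only [Set.mem_Ico] at hk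
    exact ⟨⟨k - (l + 1), by omega⟩, by simp; congr 1; omega⟩
  · intro k
    rw [real_inner_comm]
    exact (inner_residual_eq_zero v m (l + 1)).2 _ (by simp; omega)

end Determinants

/-! ### Catalan paths, enumerated by their first step -/

section CatalanPaths

open DyckStep

/-- The lists of `N` steps that lead from height `h` to height `0` without going below `0`. -/
def pathsToGround : ℕ → ℕ → Finset (List DyckStep)
  | 0, 0 => {[]}
  | 0, _ + 1 => ∅
  | N + 1, 0 => (pathsToGround N 1).map ⟨List.cons U, List.cons_injective⟩
  | N + 1, h + 1 => (pathsToGround N (h + 2)).map ⟨List.cons U, List.cons_injective⟩ ∪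
      (pathsToGround N h).map ⟨List.cons D, List.cons_injective⟩

/-- Matches the recursive enumeration, on which the induction runs, with the prefix conditions that
define `DyckWord`. -/
lemma mem_pathsToGround {N h : ℕ} {w : List DyckStep} :
    w ∈ pathsToGround N h ↔ w.length = N ∧ w.count D = h + w.count U ∧
      ∀ i, (w.take i).count D ≤ h + (w.take i).count U := by
  have hU : ∀ (h : ℕ) (t : List DyckStep),
      (∀ i, ((U :: t).take i).count D ≤ h + ((U :: t).take i).count U) ↔
        ∀ i, (t.take i).count D ≤ h + 1 + (t.take i).count U := fun h t => by
    refine ⟨fun H i => ?_, fun H i => ?_⟩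
    · have := H (i + 1)
      simp at this; omega
    · cases i with
      | zero => simp
      | succ i => have := H i; simp; omega
  have hD : ∀ (h : ℕ) (t : List DyckStep),
      (∀ i, ((D :: t).take i).count D ≤ h + 1 + ((D :: t).take i).count U) ↔
        ∀ i, (t.take i).count D ≤ h + (t.take i).count U := fun h t => by
    refine ⟨fun H i => ?_, fun H i => ?_⟩
    · have := H (i + 1)
      simp at this; omega
    · cases i with
      | zero => simp
      | succ i => have := H i; simp; omega
  induction N generalizing h w with
  | zero =>
    rcases w with - | ⟨s, t⟩ <;> cases h <;> simp [pathsToGround]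
  | succ N ih =>
    rcases w with - | ⟨s, t⟩
    · cases h <;> simp [pathsToGround]
    · cases s
      · rw [hU]
        cases h <;> simp [pathsToGround, ih] <;> omega
      · cases h with
        | zero =>
          simp only [pathsToGround, Finset.mem_map, Function.Embedding.coeFn_mk,
            List.cons.injEq, reduceCtorEq, false_and, and_false, exists_false, false_iff]
          rintro ⟨-, -, H⟩
          simpa using H 1
        | succ h =>
          rw [hD]
          simp [pathsToGround, ih]; omega

lemma sum_pathsToGround_succ {M : Type*} [AddCommMonoid M] (f : List DyckStep → M) (N h : ℕ) :
    ∑ w ∈ pathsToGround (N + 1) (h + 1), f w =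
      ∑ w ∈ pathsToGround N (h + 2), f (U :: w) + ∑ w ∈ pathsToGround N h, f (D :: w) := by
  rw [pathsToGround, Finset.sum_union, Finset.sum_map, Finset.sum_map]
  · rfl
  · simp [Finset.disjoint_left]

lemma sum_pathsToGround_succ_zero {M : Type*} [AddCommMonoid M] (f : List DyckStep → M) (N : ℕ) :
    ∑ w ∈ pathsToGround (N + 1) 0, f w = ∑ w ∈ pathsToGround N 1, f (U :: w) := by
  rw [pathsToGround, Finset.sum_map]
  rfl

lemma pathsToGround_eq_empty {N h : ℕ} (hN : N < h) : pathsToGround N h = ∅ := by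
  refine Finset.eq_empty_of_forall_notMem fun w hw => ?_
  obtain ⟨h1, h2, -⟩ := mem_pathsToGround.1 hw
  have := w.count_le_length (a := D)
  omega

lemma catalanSum_eq_sum_pathsToGround {K : Type*} [Field K] (a : ℕ → ℕ → K) (p : Finset ℕ → K)
    (i j : ℕ) :
    catalanSum a p i j = ∑ w ∈ pathsToGround (2 * (j - i)) 0, pathWeight a p i i w := by
  refine Finset.sum_bij (fun w _ => w.1.toList) (fun w _ => ?_) (fun x _ y _ hxy => ?_)
    (fun w hw => ?_) fun _ _ => rfl
  · rw [mem_pathsToGround, ← DyckWord.two_mul_semilength_eq_length, w.2, zero_add]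
    exact ⟨rfl, w.1.count_U_eq_count_D.symm, by simpa using w.1.count_D_le_count_U⟩
  · exact Subtype.ext (DyckWord.ext hxy)
  · obtain ⟨h1, h2, h3⟩ := mem_pathsToGround.1 hw
    let q : DyckWord := ⟨w, by omega, by simpa using h3⟩
    have hq : 2 * q.semilength = w.length := q.two_mul_semilength_eq_length
    exact ⟨⟨q, by omega⟩, Finset.mem_univ _, rfl⟩

variable {K : Type*} [Field K] (a : ℕ → ℕ → K) (p : Finset ℕ → K)

lemma pathWeight_U_U (l r : ℕ) (t : List DyckStep) :
    pathWeight a p l r (U :: U :: t) = pathWeight a p l (r + 1) (U :: t) := by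
  rw [pathWeight]; simp

lemma pathWeight_U_D (l r : ℕ) (t : List DyckStep) :
    pathWeight a p l r (U :: D :: t) =
      a l (r + 1) / p (Finset.Ioo l (r + 1)) * pathWeight a p l (r + 1) (D :: t) := by
  rw [pathWeight]

lemma pathWeight_D_U (l r : ℕ) (t : List DyckStep) :
    pathWeight a p l r (D :: U :: t) =
      (if l + 1 = r then 1 else a (l + 1) r) / p (Finset.Icc (l + 1) r) *
        pathWeight a p (l + 1) r (U :: t) := by
  rw [pathWeight]

lemma pathWeight_D_D (l r : ℕ) (t : List DyckStep) :
    pathWeight a p l r (D :: D :: t) = pathWeight a p (l + 1) r (D :: t) := by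
  rw [pathWeight]; simp

lemma pathWeight_D_nil (l r : ℕ) : pathWeight a p l r [D] = 1 := by
  simp [pathWeight]

end CatalanPaths

/-! ### Path sums as inner products -/

section PathFormula

variable {E : Type*} [NormedAddCommGroup E] [InnerProductSpace ℝ E] (v : ℕ → E)

open scoped InnerProductSpace
open DyckStep

lemma inner_rightResidual_succ_self (m l : ℕ) :
    ⟪rightResidual v (m + 1) l, rightResidual v (m + 1) l⟫_ℝ =
      ⟪rightResidual v m (l + 1), rightResidual v m (l + 1)⟫_ℝ -
        ⟪leftResidual v m l, rightResidual v m (l + 1)⟫_ℝ ^ 2 /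
          ⟪leftResidual v m l, leftResidual v m l⟫_ℝ := by
  by_cases h : leftResidual v m l = 0
  · simp [rightResidual_succ, h]
  · have h' := inner_self_ne_zero (𝕜 := ℝ).2 h
    rw [rightResidual_succ]
    simp only [inner_sub_left, inner_sub_right, real_inner_smul_left, real_inner_smul_right,
      real_inner_comm (leftResidual v m l) (rightResidual v m (l + 1))]
    field_simp
    ring

/-- The recursion in the form needed after a descending step: the coefficient of the left residual
is the weight of a local minimum, and the other term is a continued descent. -/
lemma smul_rightResidual_succ (m l : ℕ) (hL : leftResidual v m l ≠ 0)
    (hR : rightResidual v m (l + 1) ≠ 0) (hR' : rightResidual v (m + 1) l ≠ 0) :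
    (⟪rightResidual v (m + 1) l, rightResidual v (m + 1) l⟫_ℝ)⁻¹ • rightResidual v (m + 1) l =
      (-⟪leftResidual v m l, rightResidual v m (l + 1)⟫_ℝ /
        (⟪leftResidual v m l, leftResidual v m l⟫_ℝ *
          ⟪rightResidual v (m + 1) l, rightResidual v (m + 1) l⟫_ℝ)) •
            leftResidual v (m + 1) l +
      (⟪rightResidual v m (l + 1), rightResidual v m (l + 1)⟫_ℝ)⁻¹ •
        rightResidual v m (l + 1) := by
  have h1 := inner_self_ne_zero (𝕜 := ℝ).2 hL
  have h2 := inner_self_ne_zero (𝕜 := ℝ).2 hR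
  have h3 := inner_self_ne_zero (𝕜 := ℝ).2 hR'
  have h4 := inner_rightResidual_succ_self v m l
  set r' := ⟪rightResidual v (m + 1) l, rightResidual v (m + 1) l⟫_ℝ
  rw [rightResidual_succ, leftResidual_succ]
  set x := leftResidual v m l
  set y := rightResidual v m (l + 1)
  rw [eq_sub_iff_add_eq, ← eq_sub_iff_add_eq'] at h4
  -- Comparison of the coefficients of `y`; this is Pythagoras (`h4`) after division.
  have h5 : r'⁻¹ = ⟪x, y⟫_ℝ ^ 2 / (⟪x, x⟫_ℝ * r' * ⟪y, y⟫_ℝ) + (⟪y, y⟫_ℝ)⁻¹ := by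
    rw [div_eq_iff h1] at h4
    field_simp
    linear_combination -h4
  rw [smul_sub, h5]
  match_scalars
  · field_simp
  · rw [mul_one, ← h5]; field_simp

/-- The weighted sums over the paths from a given lattice point to the node `j`, sorted by the
direction of the first step. -/
lemma sum_pathWeight_eq_inner {a : ℕ → ℕ → ℝ} {p : Finset ℕ → ℝ} {j : ℕ}
    (hne : ∀ m l, l + m ≤ j → leftResidual v m l ≠ 0 ∧ rightResidual v m l ≠ 0)
    (hmax : ∀ m l, l + m + 1 ≤ j → a l (l + m + 1) / p (Finset.Ioo l (l + m + 1)) =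
      ⟪leftResidual v m l, rightResidual v m (l + 1)⟫_ℝ)
    (hmin0 : ∀ l ≤ j, p (Finset.Icc l l) = ⟪v l, v l⟫_ℝ)
    (hmin : ∀ m l, l + m + 1 ≤ j → a l (l + m + 1) / p (Finset.Icc l (l + m + 1)) =
      -⟪leftResidual v m l, rightResidual v m (l + 1)⟫_ℝ /
        (⟪leftResidual v m l, leftResidual v m l⟫_ℝ *
          ⟪rightResidual v (m + 1) l, rightResidual v (m + 1) l⟫_ℝ)) (N : ℕ) :
    (∀ l h, l + h ≤ j → 2 * l + h + 1 + N = 2 * j →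
      ∑ w ∈ pathsToGround N (h + 1), pathWeight a p l (l + h) (U :: w) =
        ⟪leftResidual v h l, v j⟫_ℝ) ∧
    (∀ l h, l + h + 1 ≤ j → 2 * l + h + 2 + N = 2 * j →
      ∑ w ∈ pathsToGround N h, pathWeight a p l (l + h + 1) (D :: w) =
        ⟪(⟪rightResidual v h (l + 1), rightResidual v h (l + 1)⟫_ℝ)⁻¹ •
          rightResidual v h (l + 1), v j⟫_ℝ) := by
  induction N with
  | zero =>
    constructor
    · intro l h hj hN
      rw [pathsToGround, Finset.sum_empty]
      exact ((inner_residual_eq_zero v h l).1 j ⟨by omega, by omega⟩).symm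
    · intro l h hj hN
      obtain rfl : h = 0 := by omega
      obtain rfl : j = l + 1 := by omega
      have := inner_self_ne_zero (𝕜 := ℝ).2 (hne 0 (l + 1) (by omega)).1
      rw [leftResidual_zero] at this
      simp only [pathsToGround, Finset.sum_singleton, pathWeight_D_nil, rightResidual_zero]
      rw [real_inner_smul_left, inv_mul_cancel₀ this]
  | succ N ih =>
    constructor
    · intro l h hj hN
      -- Rising further would overshoot node `j`, so there is no path; correspondingly the left
      -- residual is orthogonal to `v j`, the last vector of its block.
      by_cases hlj : l + h = j
      · rw [pathsToGround_eq_empty (by omega), Finset.sum_empty]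
        exact ((inner_residual_eq_zero v h l).1 j ⟨by omega, by omega⟩).symm
      · have h1 := ih.1 l (h + 1) (by omega) (by omega)
        have h2 := ih.2 l h (by omega) (by omega)
        rw [sum_pathsToGround_succ]
        simp only [pathWeight_U_U, pathWeight_U_D, ← Finset.mul_sum]
        rw [h2, ← add_assoc] at *
        rw [h1, hmax h l (by omega), leftResidual_succ]
        simp only [inner_sub_left, real_inner_smul_left]
        ring
    · intro l h hj hN
      have h1 := ih.1 (l + 1) h (by omega) (by omega)
      rw [show l + 1 + h = l + h + 1 by ring] at h1
      -- For `h = 0` the path touches the axis: it must rise next, and the unlabelled minimum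
      -- contributes only the inverse squared norm of `v (l + 1)`.
      cases h with
      | zero =>
        rw [sum_pathsToGround_succ_zero]
        simp only [pathWeight_D_U, ← Finset.mul_sum]
        rw [h1, add_zero, if_pos trivial, hmin0 _ (by omega)]
        simp only [leftResidual_zero, rightResidual_zero, real_inner_smul_left, one_div]
      | succ h =>
        have h2 := ih.2 (l + 1) h (by omega) (by omega)
        rw [show l + 1 + h + 1 = l + (h + 1) + 1 by ring] at h2
        rw [sum_pathsToGround_succ]
        simp only [pathWeight_D_U, pathWeight_D_D, ← Finset.mul_sum]
        rw [h1, h2, if_neg (by omega), show l + (h + 1) + 1 = l + 1 + h + 1 by ring,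
          hmin h (l + 1) (by omega),
          smul_rightResidual_succ v h (l + 1) (hne _ _ (by omega)).1 (hne _ _ (by omega)).2
            (hne _ _ (by omega)).2, inner_add_left, real_inner_smul_left, real_inner_smul_left]

end PathFormula

/-! ### Connected minors and correlations of a Gram matrix -/

section GramMatrices

variable {E : Type*} [NormedAddCommGroup E] [InnerProductSpace ℝ E]

open scoped InnerProductSpace

/-- The index sets enter only through membership, so `insert i (Finset.Ioo i j)` and `Finset.Icc r
s` are treated alike. -/
lemma sortedMinor_eq_gramDet {n : ℕ} {v : ℕ → E} {Y : Matrix (Fin n) (Fin n) ℝ}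
    (hY : ∀ i j : Fin n, Y i j = ⟪v i, v j⟫_ℝ) {I J : Finset (Fin n)} {l r m : ℕ}
    (hl : l + m ≤ n) (hr : r + m ≤ n) (hI : ∀ x : Fin n, x ∈ I ↔ l ≤ x ∧ (x : ℕ) < l + m)
    (hJ : ∀ x : Fin n, x ∈ J ↔ r ≤ x ∧ (x : ℕ) < r + m) :
    I.card = m ∧ sortedMinor Y I J = gramDet v l r m := by
  have hcard : ∀ (K : Finset (Fin n)) (s : ℕ) (_ : s + m ≤ n)
      (_ : ∀ x : Fin n, x ∈ K ↔ s ≤ x ∧ (x : ℕ) < s + m), K.card = m := by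
    intro K s hs hK
    have h1 : K.map Fin.valEmbedding = Finset.Ico s (s + m) := by
      ext x
      simp only [Finset.mem_map, hK, Fin.valEmbedding_apply, Finset.mem_Ico]
      exact ⟨by rintro ⟨y, hy, rfl⟩; exact hy, fun hx => ⟨⟨x, by omega⟩, hx, rfl⟩⟩
    rw [← Finset.card_map Fin.valEmbedding, h1, Nat.card_Ico, Nat.add_sub_cancel_left]
  have hIm := hcard I l hl hI
  have hJm := hcard J r hr hJ
  refine ⟨hIm, ?_⟩
  subst hIm
  have hfI := Finset.orderEmbOfFin_unique (s := I) rfl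
    (f := fun k : Fin I.card => (⟨l + k, by omega⟩ : Fin n))
    (fun k => (hI _).2 ⟨by simp, by simp⟩) (fun x y h => by simpa using h)
  have hfJ := Finset.orderEmbOfFin_unique (s := J) hJm
    (f := fun k : Fin I.card => (⟨r + k, by omega⟩ : Fin n))
    (fun k => (hJ _).2 ⟨by simp, by simp⟩) (fun x y h => by simpa using h)
  rw [sortedMinor, dif_pos hJm, gramDet, ← hfI, ← hfJ]
  congr 1
  ext a b
  simp [hY]

lemma principalMinor_eq_gramDet {n : ℕ} {v : ℕ → E} {Y : Matrix (Fin n) (Fin n) ℝ}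
    (hY : ∀ i j : Fin n, Y i j = ⟪v i, v j⟫_ℝ) {I : Finset (Fin n)} {l m : ℕ}
    (hl : l + m ≤ n) (hI : ∀ x : Fin n, x ∈ I ↔ l ≤ x ∧ (x : ℕ) < l + m) :
    principalMinor Y I = (-1) ^ (m / 2) * gramDet v l l m := by
  obtain ⟨h1, h2⟩ := sortedMinor_eq_gramDet hY hl hl hI hI
  rw [principalMinor, h1, h2]

lemma almostPrincipalMinor_eq_gramDet {n : ℕ} {v : ℕ → E} {Y : Matrix (Fin n) (Fin n) ℝ}
    (hY : ∀ i j : Fin n, Y i j = ⟪v i, v j⟫_ℝ) {i j : Fin n} {m : ℕ} (hj : (j : ℕ) = i + m + 1) :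
    (Finset.Ioo i j).card = m ∧ almostPrincipalMinor Y i j (Finset.Ioo i j) =
      (-1) ^ ((m + 1) / 2) * gramDet v i (i + 1) (m + 1) := by
  have h1 : (Finset.Ioo i j).card = m := by rw [Fin.card_Ioo]; omega
  obtain ⟨-, h2⟩ := sortedMinor_eq_gramDet hY (I := insert i (Finset.Ioo i j))
    (J := insert j (Finset.Ioo i j)) (l := i) (r := i + 1) (m := m + 1) (by omega) (by omega)
    (fun x => by
        rw [Finset.mem_insert, Finset.mem_Ioo, Fin.ext_iff, Fin.lt_def, Fin.lt_def]; omega)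
    (fun x => by
        rw [Finset.mem_insert, Finset.mem_Ioo, Fin.ext_iff, Fin.lt_def, Fin.lt_def]; omega)
  exact ⟨h1, by rw [almostPrincipalMinor, h1, h2]⟩

/-- The correlation of the two residuals that are combined by the lattice recursion. -/
noncomputable def residualCorrelation (v : ℕ → E) (m l : ℕ) : ℝ :=
  ⟪leftResidual v m l, rightResidual v m (l + 1)⟫_ℝ /
    Real.sqrt (⟪leftResidual v m l, leftResidual v m l⟫_ℝ *
      ⟪rightResidual v m (l + 1), rightResidual v m (l + 1)⟫_ℝ)

/-- All residuals of the first `n` vectors of `v` are nonzero. -/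
def ResidualsNonzero (v : ℕ → E) (n : ℕ) : Prop :=
  ∀ m l, l + m < n → leftResidual v m l ≠ 0 ∧ rightResidual v m l ≠ 0

variable {v : ℕ → E} {n : ℕ}

lemma ResidualsNonzero.left_pos (hv : ResidualsNonzero v n) {m l : ℕ} (h : l + m < n) :
    0 < ⟪leftResidual v m l, leftResidual v m l⟫_ℝ :=
  real_inner_self_pos.2 (hv m l h).1

lemma ResidualsNonzero.right_pos (hv : ResidualsNonzero v n) {m l : ℕ} (h : l + m < n) :
    0 < ⟪rightResidual v m l, rightResidual v m l⟫_ℝ :=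
  real_inner_self_pos.2 (hv m l h).2

lemma ResidualsNonzero.gramDet_pos (hv : ResidualsNonzero v n) {m l : ℕ} (h : l + m ≤ n) :
    0 < gramDet v l l m := by
  induction m with
  | zero => simp [gramDet]
  | succ m ih =>
    rw [gramDet_succ_right]
    exact mul_pos (hv.right_pos (by omega)) (ih (by omega))

lemma ResidualsNonzero.inner_rightResidual_succ_self (hv : ResidualsNonzero v n) {m l : ℕ}
    (h : l + m + 1 < n) :
    ⟪rightResidual v (m + 1) l, rightResidual v (m + 1) l⟫_ℝ =
      ⟪rightResidual v m (l + 1), rightResidual v m (l + 1)⟫_ℝ *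
        (1 - residualCorrelation v m l ^ 2) := by
  have h1 := hv.left_pos (m := m) (l := l) (by omega)
  have h2 := hv.right_pos (m := m) (l := l + 1) (by omega)
  rw [_root_.inner_rightResidual_succ_self, residualCorrelation, div_pow,
    Real.sq_sqrt (mul_pos h1 h2).le]
  field_simp

lemma ResidualsNonzero.residualCorrelation_sq_lt_one (hv : ResidualsNonzero v n) {m l : ℕ}
    (h : l + m + 1 < n) : residualCorrelation v m l ^ 2 < 1 := by
  have h1 := hv.right_pos (m := m) (l := l + 1) (by omega)
  have h2 := hv.right_pos (m := m + 1) (l := l) (by omega)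
  rw [hv.inner_rightResidual_succ_self h] at h2
  linarith [pos_of_mul_pos_right h2 h1.le]

lemma neg_one_pow_half_mul_half_succ (m : ℕ) :
    (-1 : ℝ) ^ (m / 2) * (-1) ^ ((m + 1) / 2) = (-1) ^ m := by
  rw [← pow_add]; congr 1; omega

lemma neg_one_pow_mul_self (m : ℕ) : (-1 : ℝ) ^ m * (-1) ^ m = 1 := by
  rw [← mul_pow]; norm_num

/-- Peeling the first vector off one block and the last off the other leaves the same interior
determinant twice. -/
lemma ResidualsNonzero.sqrt_gramDet_mul_gramDet (hv : ResidualsNonzero v n) {m l : ℕ}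
    (h : l + m + 1 < n) :
    Real.sqrt (gramDet v l l (m + 1) * gramDet v (l + 1) (l + 1) (m + 1)) =
      Real.sqrt (⟪leftResidual v m l, leftResidual v m l⟫_ℝ *
        ⟪rightResidual v m (l + 1), rightResidual v m (l + 1)⟫_ℝ) *
          gramDet v (l + 1) (l + 1) m := by
  have h3 := hv.gramDet_pos (m := m) (l := l + 1) (by omega)
  rw [gramDet_succ_left v l, gramDet_succ_right v (l + 1), mul_mul_mul_comm, Real.sqrt_mul',
    Real.sqrt_mul_self h3.le]
  positivity

lemma ResidualsNonzero.sqrt_pos (hv : ResidualsNonzero v n) {m l : ℕ} (h : l + m + 1 < n) :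
    0 < Real.sqrt (⟪leftResidual v m l, leftResidual v m l⟫_ℝ *
      ⟪rightResidual v m (l + 1), rightResidual v m (l + 1)⟫_ℝ) :=
  Real.sqrt_pos.2 (mul_pos (hv.left_pos (by omega)) (hv.right_pos (by omega)))

/-- The interior determinant cancels between numerator and root. The signs in the definitions cancel
in pairs, leaving only that of `gramDet_succ_offDiag`. -/
lemma ResidualsNonzero.connectedCorrelations_eq (hv : ResidualsNonzero v n)
    {Y : Matrix (Fin n) (Fin n) ℝ} (hY : ∀ i j : Fin n, Y i j = ⟪v i, v j⟫_ℝ) (e : IndexPair n)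
    {m : ℕ} (hm : (e.1.2 : ℕ) = e.1.1 + m + 1) :
    connectedCorrelations Y e = (-1) ^ m * residualCorrelation v m e.1.1 := by
  obtain ⟨⟨i, j⟩, hij⟩ := e
  dsimp only at *
  have hn : (i : ℕ) + m + 1 < n := by omega
  obtain ⟨h1, h2⟩ := almostPrincipalMinor_eq_gramDet hY hm
  have h3 := hv.gramDet_pos (m := m) (l := i + 1) (by omega)
  have h4 := hv.sqrt_pos hn
  have hI : ∀ x : Fin n, x ∈ insert i (Finset.Ioo i j) ↔ i ≤ (x : ℕ) ∧ (x : ℕ) < i + (m + 1) :=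
    fun x => by rw [Finset.mem_insert, Finset.mem_Ioo, Fin.ext_iff, Fin.lt_def, Fin.lt_def]; omega
  have hJ : ∀ x : Fin n, x ∈ insert j (Finset.Ioo i j) ↔
      i + 1 ≤ (x : ℕ) ∧ (x : ℕ) < i + 1 + (m + 1) :=
    fun x => by rw [Finset.mem_insert, Finset.mem_Ioo, Fin.ext_iff, Fin.lt_def, Fin.lt_def]; omega
  rw [connectedCorrelations, partialCorrelation, h1,
    principalMinor_eq_gramDet hY (by omega) hI, principalMinor_eq_gramDet hY (by omega) hJ, h2,
    mul_mul_mul_comm,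
    neg_one_pow_mul_self, one_mul, hv.sqrt_gramDet_mul_gramDet hn, ← mul_assoc,
    neg_one_pow_mul_self, one_mul, gramDet_succ_offDiag, residualCorrelation]
  field_simp

/-- The parameters `ρ` are the signed residual correlations of the first `n` vectors of `v`. -/
def IsCorrelationOf (ρ : IndexPair n → ℝ) (v : ℕ → E) : Prop :=
  ∀ m l, l + m + 1 < n → param ρ l (l + m + 1) = (-1) ^ m * residualCorrelation v m l

lemma ResidualsNonzero.isCorrelationOf (hv : ResidualsNonzero v n)
    {Y : Matrix (Fin n) (Fin n) ℝ} (hY : ∀ i j : Fin n, Y i j = ⟪v i, v j⟫_ℝ) :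
    IsCorrelationOf (connectedCorrelations Y) v := by
  intro m l h
  rw [param, dif_pos ⟨by omega, h⟩, hv.connectedCorrelations_eq hY _ rfl]

lemma ResidualsNonzero.connectedCorrelations_mem_openCube (hv : ResidualsNonzero v n)
    {Y : Matrix (Fin n) (Fin n) ℝ} (hY : ∀ i j : Fin n, Y i j = ⟪v i, v j⟫_ℝ) :
    connectedCorrelations Y ∈ openCube n := by
  intro e
  have he : (e.1.1 : ℕ) < e.1.2 := e.2
  obtain ⟨m, hm⟩ := Nat.exists_eq_add_of_lt he
  rw [hv.connectedCorrelations_eq hY e hm, Set.mem_Ioo, ← abs_lt, ← sq_lt_one_iff_abs_lt_one,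
    mul_pow, ← pow_mul, mul_comm m, pow_mul, neg_one_sq, one_pow, one_mul]
  exact hv.residualCorrelation_sq_lt_one (by omega)

variable {ρ : IndexPair n → ℝ}

lemma IsCorrelationOf.sq_eq (hρ : IsCorrelationOf ρ v) {m l : ℕ} (h : l + m + 1 < n) :
    param ρ l (l + m + 1) ^ 2 = residualCorrelation v m l ^ 2 := by
  rw [hρ m l h, mul_pow, ← pow_mul, mul_comm m, pow_mul, neg_one_sq, one_pow, one_mul]

/-- Iterated Pythagoras: each further vector projected off the unit vector `v (l + m)` costs one
factor 1 - ρ². -/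
lemma IsCorrelationOf.inner_rightResidual_self (hρ : IsCorrelationOf ρ v)
    (hv : ResidualsNonzero v n) (hone : ∀ i < n, ⟪v i, v i⟫_ℝ = 1) {m l : ℕ} (h : l + m < n) :
    ⟪rightResidual v m l, rightResidual v m l⟫_ℝ =
      ∏ k ∈ Finset.Ico l (l + m), (1 - param ρ k (l + m) ^ 2) := by
  induction m generalizing l with
  | zero =>
    simp only [rightResidual_zero, add_zero, Finset.Ico_self, Finset.prod_empty]
    exact hone l h
  | succ m ih =>
    rw [hv.inner_rightResidual_succ_self h, ih (by omega), ← hρ.sq_eq h,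
      show l + (m + 1) = l + 1 + m by ring,
      Finset.prod_eq_prod_Ico_succ_bot (show l < l + 1 + m by omega),
      mul_comm, show l + m + 1 = l + 1 + m by ring]

/-- A new last index multiplies the Gram determinant by the squared norm of its residual, which
accounts for exactly the pairs ending there. -/
lemma IsCorrelationOf.replacedP_Ico (hρ : IsCorrelationOf ρ v) (hv : ResidualsNonzero v n)
    (hone : ∀ i < n, ⟪v i, v i⟫_ℝ = 1) {m l : ℕ} (h : l + m ≤ n) :
    replacedP ρ (Finset.Ico l (l + m)) = (-1) ^ (m / 2) * gramDet v l l m := by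
  rw [replacedP, Nat.card_Ico, Nat.add_sub_cancel_left]
  congr 1
  induction m with
  | zero => simp [gramDet]
  | succ m ih =>
    have himg : ∀ x y, (∃ a, (l ≤ a ∧ a < l + m) ∧ a = x ∧ l + m = y) ↔
        (l ≤ x ∧ x < l + m) ∧ l + m = y := fun x y =>
      ⟨by rintro ⟨a, h1, rfl, h2⟩; exact ⟨h1, h2⟩, fun h => ⟨x, h.1, rfl, h.2⟩⟩
    rw [gramDet_succ_right, ← ih (by omega), hρ.inner_rightResidual_self hv hone (by omega),
      ← Finset.prod_image (s := Finset.Ico l (l + m)) (g := fun k => (k, l + m))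
        (f := fun e : ℕ × ℕ => 1 - param ρ e.1 e.2 ^ 2) (fun x _ y _ hxy => (Prod.ext_iff.1 hxy).1),
      ← Finset.prod_union]
    · congr 1
      ext ⟨x, y⟩
      simp only [Finset.mem_filter, Finset.mem_product, Finset.mem_Ico, Finset.mem_union,
        Finset.mem_image, Prod.mk.injEq, himg]
      omega
    · rw [Finset.disjoint_left]
      rintro ⟨x, y⟩
      simp only [Finset.mem_filter, Finset.mem_product, Finset.mem_Ico,
        Finset.mem_image, Prod.mk.injEq, himg]
      omega

lemma IsCorrelationOf.replacedA_eq (hρ : IsCorrelationOf ρ v) (hv : ResidualsNonzero v n)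
    (hone : ∀ i < n, ⟪v i, v i⟫_ℝ = 1) {m l : ℕ} (h : l + m + 1 < n) :
    replacedA ρ l (l + m + 1) = (-1) ^ ((m + 1) / 2) * gramDet v l (l + 1) (m + 1) := by
  have h4 := hv.sqrt_pos h
  have hI : Finset.Ioc l (l + m + 1) = Finset.Ico (l + 1) (l + 1 + (m + 1)) := by
    ext x; simp; omega
  rw [replacedA, Nat.card_Ioo, show l + m + 1 - l - 1 = m by omega, hI, add_assoc,
    hρ.replacedP_Ico hv hone (by omega), hρ.replacedP_Ico hv hone (by omega), mul_mul_mul_comm,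
    neg_one_pow_mul_self, one_mul, hv.sqrt_gramDet_mul_gramDet h, ← add_assoc, hρ m l h,
    gramDet_succ_offDiag, residualCorrelation]
  field_simp

lemma IsCorrelationOf.catalanSum_eq (hρ : IsCorrelationOf ρ v) (hv : ResidualsNonzero v n)
    (hone : ∀ i < n, ⟪v i, v i⟫_ℝ = 1) {i j : ℕ} (hij : i < j) (hj : j < n) :
    catalanSum (replacedA ρ) (replacedP ρ) i j = ⟪v i, v j⟫_ℝ := by
  rw [catalanSum_eq_sum_pathsToGround]
  obtain ⟨N, hN⟩ : ∃ N, 2 * (j - i) = N + 1 := ⟨2 * (j - i) - 1, by omega⟩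
  rw [hN, sum_pathsToGround_succ_zero]
  refine (sum_pathWeight_eq_inner v (j := j) (fun m l h => hv m l (by omega)) ?_ ?_ ?_ N).1 i 0
    (by omega) (by omega)
  · intro m l h
    have hD := (hv.gramDet_pos (m := m) (l := l + 1) (by omega)).ne'
    have hI : Finset.Ioo l (l + m + 1) = Finset.Ico (l + 1) (l + 1 + m) := by
      ext x; simp; omega
    have hs3 := neg_one_pow_half_mul_half_succ m
    have hs4 : (-1 : ℝ) ^ (m / 2) ≠ 0 := by simp
    rw [hI, hρ.replacedP_Ico hv hone (by omega), hρ.replacedA_eq hv hone (by omega),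
      gramDet_succ_offDiag, div_eq_iff (mul_ne_zero hs4 hD), ← hs3]
    linear_combination (⟪leftResidual v m l, rightResidual v m (l + 1)⟫_ℝ *
      gramDet v (l + 1) (l + 1) m * (-1) ^ (m / 2)) * neg_one_pow_mul_self ((m + 1) / 2)
  · intro l h
    have hI : Finset.Icc l l = Finset.Ico l (l + 1) := by ext x; simp
    rw [hI, hρ.replacedP_Ico hv hone (by omega), gramDet_succ_right]
    simp [gramDet]
  · intro m l h
    have hD := (hv.gramDet_pos (m := m) (l := l + 1) (by omega)).ne'
    have hL := (hv.left_pos (m := m) (l := l) (by omega)).ne'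
    have hR := (hv.right_pos (m := m + 1) (l := l) (by omega)).ne'
    have hI : Finset.Icc l (l + m + 1) = Finset.Ico l (l + (m + 2)) := by
      ext x; simp; omega
    have hs3 := neg_one_pow_half_mul_half_succ m
    have hs4 : (-1 : ℝ) ^ (m / 2) ≠ 0 := by simp
    -- The region above a minimum has two more indices than the one below, so its sign exponent
    -- grows by one: hence the minus sign in the weight of a minimum.
    rw [hI, hρ.replacedP_Ico hv hone (by omega), hρ.replacedA_eq hv hone (by omega),
      gramDet_succ_offDiag, gramDet_succ_right, gramDet_succ_left, Nat.add_div_right _ two_pos,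
      pow_succ, ← hs3, div_eq_div_iff (mul_ne_zero (mul_ne_zero hs4 (by norm_num))
        (mul_ne_zero hR (mul_ne_zero hL hD))) (mul_ne_zero hL hR)]
    linear_combination (⟪leftResidual v m l, rightResidual v m (l + 1)⟫_ℝ *
      gramDet v (l + 1) (l + 1) m * (-1) ^ (m / 2) * ⟪leftResidual v m l, leftResidual v m l⟫_ℝ *
      ⟪rightResidual v (m + 1) l, rightResidual v (m + 1) l⟫_ℝ) *
        neg_one_pow_mul_self ((m + 1) / 2)

lemma IsCorrelationOf.correlationMap_eq (hρ : IsCorrelationOf ρ v) (hv : ResidualsNonzero v n)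
    (hone : ∀ i < n, ⟪v i, v i⟫_ℝ = 1) {Y : Matrix (Fin n) (Fin n) ℝ}
    (hY : ∀ i j : Fin n, Y i j = ⟪v i, v j⟫_ℝ) : correlationMap n ρ = Y := by
  ext i j
  rw [correlationMap, Matrix.of_apply, hY]
  rcases lt_trichotomy i j with h | rfl | h
  · have h' : (i : ℕ) < j := h
    rw [if_neg h.ne, min_eq_left h'.le, max_eq_right h'.le, hρ.catalanSum_eq hv hone h' j.2]
  · rw [if_pos rfl, hone i i.2]
  · have h' : (j : ℕ) < i := h
    rw [if_neg h.ne', min_eq_right h'.le, max_eq_left h'.le, hρ.catalanSum_eq hv hone h' i.2,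
      real_inner_comm]

end GramMatrices

open scoped InnerProductSpace in
/-- Every correlation matrix is the Gram matrix of linearly independent unit vectors. -/
lemma exists_gram_of_mem_openElliptope {n : ℕ} {Y : Matrix (Fin n) (Fin n) ℝ}
    (hY : Y ∈ openElliptope n) :
    ∃ v : ℕ → EuclideanSpace ℝ (Fin n), ResidualsNonzero v n ∧ (∀ i < n, ⟪v i, v i⟫_ℝ = 1) ∧
      ∀ i j : Fin n, Y i j = ⟪v i, v j⟫_ℝ := by
  obtain ⟨hpos, hdiag⟩ := hY
  obtain ⟨B, hB⟩ : ∃ B : Matrix (Fin n) (Fin n) ℝ, Y = B.conjTranspose * B := by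
    open scoped MatrixOrder Matrix.Norms.L2Operator in
    exact CStarAlgebra.nonneg_iff_eq_star_mul_self.1 hpos.posSemidef.nonneg
  -- The columns of `B`, padded with zeros from index `n` on.
  let v : ℕ → EuclideanSpace ℝ (Fin n) := fun i =>
    if h : i < n then WithLp.toLp 2 fun k => B k ⟨i, h⟩ else 0
  have hv : ∀ i j : Fin n, Y i j = ⟪v i, v j⟫_ℝ := by
    intro i j
    simp [v, hB, Matrix.mul_apply, PiLp.inner_apply, mul_comm]
  refine ⟨v, fun m l h => residual_ne_zero v ?_ h, fun i hi => ?_, hv⟩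
  · refine Matrix.linearIndependent_of_posDef_gram ?_
    have : Matrix.gram ℝ (fun i : Fin n => v i) = Y := by
      ext i j
      rw [hv, Matrix.gram_apply]
    rwa [this]
  · rw [← hv ⟨i, hi⟩ ⟨i, hi⟩, hdiag]

/-! ### Vectors with prescribed residual correlations -/

section PrescribedCorrelations

variable {E : Type*} [NormedAddCommGroup E] [InnerProductSpace ℝ E]

open scoped InnerProductSpace

/-- The unit vectors obtained from `u 0` by successive rotations in the planes spanned with
`u 1, u 2, …`. -/
noncomputable def leftFrame (κ : ℕ → ℝ) (u : ℕ → E) : ℕ → E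
  | 0 => u 0
  | m + 1 => Real.sqrt (1 - κ m ^ 2) • leftFrame κ u m - κ m • u (m + 1)

/-- The vectors that complement the `leftFrame` in the rotations that define it. -/
noncomputable def rightFrame (κ : ℕ → ℝ) (u : ℕ → E) (m : ℕ) : E :=
  κ m • leftFrame κ u m + Real.sqrt (1 - κ m ^ 2) • u (m + 1)

variable {κ : ℕ → ℝ} {u : ℕ → E}

lemma inner_leftFrame_of_lt (hu : Orthonormal ℝ u) {m k : ℕ} (h : m < k) :
    ⟪leftFrame κ u m, u k⟫_ℝ = 0 := by
  induction m with
  | zero => exact hu.2 h.ne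
  | succ m ih =>
    rw [leftFrame, inner_sub_left, real_inner_smul_left, real_inner_smul_left,
      ih (by omega), hu.2 h.ne]
    simp

lemma inner_leftFrame_self (hu : Orthonormal ℝ u) (hκ : ∀ m, κ m ^ 2 < 1) (m : ℕ) :
    ⟪leftFrame κ u m, leftFrame κ u m⟫_ℝ = 1 := by
  induction m with
  | zero => rw [leftFrame, real_inner_self_eq_norm_sq, hu.1, one_pow]
  | succ m ih =>
    have h1 : ⟪u (m + 1), u (m + 1)⟫_ℝ = 1 := by
      rw [real_inner_self_eq_norm_sq, hu.1, one_pow]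
    have h2 := inner_leftFrame_of_lt (κ := κ) hu m.lt_succ_self
    rw [leftFrame]
    simp only [inner_sub_left, inner_sub_right, real_inner_smul_left, real_inner_smul_right, ih,
      h1, h2, real_inner_comm (leftFrame κ u m) (u (m + 1))]
    linear_combination Real.sq_sqrt (sub_nonneg.2 (hκ m).le)

/-- A rotation takes the orthonormal pair `leftFrame κ u m`, `u (m + 1)` to `leftFrame κ u (m + 1)`,
`rightFrame κ u m`. Later members are built from the former and further `u k`, all orthogonal to
`rightFrame κ u m`. -/
lemma orthonormal_rightFrame (hu : Orthonormal ℝ u) (hκ : ∀ m, κ m ^ 2 < 1) :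
    Orthonormal ℝ (rightFrame κ u) := by
  have hone : ∀ m, ⟪u m, u m⟫_ℝ = 1 := fun m => by
    rw [real_inner_self_eq_norm_sq, hu.1, one_pow]
  have hR : ∀ m k, m < k → ⟪rightFrame κ u m, u (k + 1)⟫_ℝ = 0 := fun m k h => by
    rw [rightFrame, inner_add_left, real_inner_smul_left, real_inner_smul_left,
      inner_leftFrame_of_lt hu (by omega), hu.2 (by omega)]
    simp
  have hL : ∀ m k, m < k → ⟪rightFrame κ u m, leftFrame κ u k⟫_ℝ = 0 := by
    intro m k h
    induction k, h using Nat.le_induction with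
    | base =>
      rw [rightFrame, leftFrame]
      simp only [inner_sub_right, inner_add_left, real_inner_smul_left, real_inner_smul_right,
        inner_leftFrame_self hu hκ, inner_leftFrame_of_lt (κ := κ) hu m.lt_succ_self, hone,
        real_inner_comm (leftFrame κ u m) (u (m + 1))]
      ring
    | succ k hk ih =>
      rw [leftFrame, inner_sub_right, real_inner_smul_right, real_inner_smul_right, ih,
        hR m k hk]
      simp
  have hlt : ∀ m k, m < k → ⟪rightFrame κ u m, rightFrame κ u k⟫_ℝ = 0 := fun m k h => by
    conv_lhs => rw [rightFrame.eq_1 κ u k]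
    rw [inner_add_right, real_inner_smul_right, real_inner_smul_right, hR m k h, hL m k h]
    simp
  refine ⟨fun m => ?_, fun m k h => ?_⟩
  · rw [← sq_eq_sq₀ (norm_nonneg _) zero_le_one, ← real_inner_self_eq_norm_sq, rightFrame]
    simp only [inner_add_right, inner_add_left, real_inner_smul_left, real_inner_smul_right,
      inner_leftFrame_self hu hκ, inner_leftFrame_of_lt (κ := κ) hu m.lt_succ_self, hone,
      real_inner_comm (leftFrame κ u m) (u (m + 1))]
    linear_combination Real.sq_sqrt (sub_nonneg.2 (hκ m).le)
  · rcases h.lt_or_gt with h | h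
    · exact hlt m k h
    · rw [real_inner_comm, hlt k m h]

/-- The frames of normalized right residuals with prescribed residual correlations `κ l m`. -/
noncomputable def residualFrame (κ : ℕ → ℕ → ℝ) (u : ℕ → E) : ℕ → ℕ → E
  | 0 => u
  | l + 1 => rightFrame (κ l) (residualFrame κ u l)

lemma orthonormal_residualFrame {κ : ℕ → ℕ → ℝ} (hu : Orthonormal ℝ u)
    (hκ : ∀ l m, κ l m ^ 2 < 1) (l : ℕ) : Orthonormal ℝ (residualFrame κ u l) := by
  induction l with
  | zero => exact hu
  | succ l ih => exact orthonormal_rightFrame ih (hκ l)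

/-- The unit vectors `leftFrame (κ l) (residualFrame κ u l) m` and `residualFrame κ u (l + 1) m`
have inner product `κ l m`. Projecting each off the other undoes the rotation, up to the factor √(1
- κ²). -/
lemma residual_eq_smul_frame {κ : ℕ → ℕ → ℝ} (hu : Orthonormal ℝ u)
    (hκ : ∀ l m, κ l m ^ 2 < 1) {v : ℕ → E} (hv : ∀ l, v l = residualFrame κ u l 0) (m l : ℕ) :
    (∃ a > (0 : ℝ), leftResidual v m l = a • leftFrame (κ l) (residualFrame κ u l) m) ∧
      ∃ b > (0 : ℝ), rightResidual v m l = b • residualFrame κ u l m := by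
  induction m generalizing l with
  | zero => exact ⟨⟨1, one_pos, by simp [hv, leftFrame]⟩, 1, one_pos, by simp [hv]⟩
  | succ m ih =>
    obtain ⟨a, ha, hL⟩ := (ih l).1
    obtain ⟨b, hb, hR⟩ := (ih (l + 1)).2
    have hfr := orthonormal_residualFrame hu hκ l
    have hγ : 0 < Real.sqrt (1 - κ l m ^ 2) := Real.sqrt_pos.2 (sub_pos.2 (hκ l m))
    have hγ2 := Real.sq_sqrt (sub_nonneg.2 (hκ l m).le)
    have hLL := inner_leftFrame_self hfr (hκ l) m
    have hRR : ⟪residualFrame κ u (l + 1) m, residualFrame κ u (l + 1) m⟫_ℝ = 1 := by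
      rw [real_inner_self_eq_norm_sq, (orthonormal_residualFrame hu hκ (l + 1)).1, one_pow]
    have hdef : residualFrame κ u (l + 1) m =
      κ l m • leftFrame (κ l) (residualFrame κ u l) m +
        Real.sqrt (1 - κ l m ^ 2) • residualFrame κ u l (m + 1) := rfl
    have hLR : ⟪leftFrame (κ l) (residualFrame κ u l) m, residualFrame κ u (l + 1) m⟫_ℝ =
        κ l m := by
      rw [hdef, inner_add_right, real_inner_smul_right, real_inner_smul_right, hLL,
        inner_leftFrame_of_lt hfr m.lt_succ_self]
      simp
    refine ⟨⟨a * Real.sqrt (1 - κ l m ^ 2), mul_pos ha hγ, ?_⟩,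
      b * Real.sqrt (1 - κ l m ^ 2), mul_pos hb hγ, ?_⟩
    · rw [leftResidual_succ, hL, hR, leftFrame]
      simp only [real_inner_smul_left, real_inner_smul_right, hLR, hRR]
      rw [hdef]
      match_scalars
      · field_simp
        linear_combination -hγ2
      · field_simp
    · rw [rightResidual_succ, hL, hR]
      simp only [real_inner_smul_left, real_inner_smul_right, hLR, hLL]
      rw [hdef]
      match_scalars
      · field_simp
        ring
      · field_simp

lemma residualCorrelation_of_frame {κ : ℕ → ℕ → ℝ} (hu : Orthonormal ℝ u)
    (hκ : ∀ l m, κ l m ^ 2 < 1) {v : ℕ → E} (hv : ∀ l, v l = residualFrame κ u l 0) (m l : ℕ) :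
    residualCorrelation v m l = κ l m := by
  obtain ⟨a, ha, hL⟩ := (residual_eq_smul_frame hu hκ hv m l).1
  obtain ⟨b, hb, hR⟩ := (residual_eq_smul_frame hu hκ hv m (l + 1)).2
  have hfr := orthonormal_residualFrame hu hκ l
  have hLL := inner_leftFrame_self hfr (hκ l) m
  have hRR : ⟪residualFrame κ u (l + 1) m, residualFrame κ u (l + 1) m⟫_ℝ = 1 := by
    rw [real_inner_self_eq_norm_sq, (orthonormal_residualFrame hu hκ (l + 1)).1, one_pow]
  have hLR : ⟪leftFrame (κ l) (residualFrame κ u l) m, residualFrame κ u (l + 1) m⟫_ℝ =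
      κ l m := by
    rw [residualFrame, rightFrame, inner_add_right, real_inner_smul_right, real_inner_smul_right,
      hLL, inner_leftFrame_of_lt hfr m.lt_succ_self]
    simp
  rw [residualCorrelation, hL, hR]
  simp only [real_inner_smul_left, real_inner_smul_right, hLR, hRR, hLL]
  rw [show a * (a * 1) * (b * (b * 1)) = (a * b) * (a * b) by ring,
    Real.sqrt_mul_self (by positivity)]
  field_simp

end PrescribedCorrelations

lemma param_sq_lt_one {n : ℕ} {ρ : IndexPair n → ℝ} (hρ : ρ ∈ openCube n) (i j : ℕ) :
    param ρ i j ^ 2 < 1 := by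
  rw [param]
  split_ifs with h
  · rw [sq_lt_one_iff_abs_lt_one, abs_lt]
    exact hρ _
  · norm_num

open scoped InnerProductSpace in
/-- Every point of the cube consists of the connected partial correlations of a correlation
matrix. -/
lemma exists_connectedCorrelations_eq {n : ℕ} {ρ : IndexPair n → ℝ} (hρ : ρ ∈ openCube n) :
    ∃ Y ∈ openElliptope n, connectedCorrelations Y = ρ := by
  -- The sign turns partial correlations into residual correlations; out of range `param` is 0, so
  -- the bound below holds for all indices.
  let κ : ℕ → ℕ → ℝ := fun l m => (-1) ^ m * param ρ l (l + m + 1)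
  have hκ : ∀ l m, κ l m ^ 2 < 1 := fun l m => by
    rw [mul_pow, ← pow_mul, mul_comm m, pow_mul, neg_one_sq, one_pow, one_mul]
    exact param_sq_lt_one hρ _ _
  -- Each new frame uses the previous one shifted by an index; an infinite orthonormal sequence
  -- never runs out.
  obtain ⟨u, hu⟩ : ∃ u : ℕ → lp (fun _ : ℕ => ℝ) 2, Orthonormal ℝ u :=
    ⟨_, (HilbertBasis.ofRepr (LinearIsometryEquiv.refl ℝ (lp (fun _ : ℕ => ℝ) 2))).orthonormal⟩
  let v := fun l => residualFrame κ u l 0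
  have hfr := orthonormal_residualFrame hu hκ
  have hne : ∀ m l, rightResidual v m l ≠ 0 := fun m l => by
    obtain ⟨b, hb, hR⟩ := (residual_eq_smul_frame hu hκ (v := v) (fun _ => rfl) m l).2
    rw [hR]
    exact smul_ne_zero hb.ne' ((hfr l).ne_zero m)
  have hli := (linearIndependent_of_rightResidual_ne_zero v fun m => hne m 0).comp
    (fun i : Fin n => (i : ℕ)) Fin.val_injective
  have hv : ResidualsNonzero v n := fun m l h => residual_ne_zero v hli h
  refine ⟨Matrix.gram ℝ fun i : Fin n => v i,
    ⟨Matrix.posDef_gram_of_linearIndependent hli, fun i => ?_⟩, ?_⟩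
  · rw [Matrix.gram_apply, real_inner_self_eq_norm_sq, (hfr i).1, one_pow]
  · ext e
    have he : (e.1.1 : ℕ) < e.1.2 := e.2
    obtain ⟨m, hm⟩ := Nat.exists_eq_add_of_lt he
    rw [hv.connectedCorrelations_eq
      (Y := Matrix.gram ℝ fun i : Fin n => v i) (fun _ _ => rfl) e hm,
      residualCorrelation_of_frame hu hκ (fun _ => rfl), ← mul_assoc, neg_one_pow_mul_self,
      one_mul, ← hm, param, dif_pos ⟨he, e.1.2.2⟩]

/-! ### Algebraicity of the entries -/

section AlgebraicFunctions

/-- The ring homomorphism that sends a polynomial in the parameters to a function on the cube. -/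
noncomputable def evalOnCube (n : ℕ) : MvPolynomial (IndexPair n) ℝ →+* (openCube n → ℝ) :=
  RingHom.pi fun ρ => MvPolynomial.eval ρ.1

/-- The subring of the functions on the cube that are algebraic over the polynomials. -/
noncomputable def algebraicOnCube (n : ℕ) : Subring (openCube n → ℝ) :=
  letI := (evalOnCube n).toAlgebra
  (Subalgebra.algebraicClosure (MvPolynomial (IndexPair n) ℝ) (openCube n → ℝ)).toSubring

variable {n : ℕ}

lemma mem_algebraicOnCube {f : openCube n → ℝ} : f ∈ algebraicOnCube n ↔
    ∃ P : Polynomial (MvPolynomial (IndexPair n) ℝ), P ≠ 0 ∧ P.eval₂ (evalOnCube n) f = 0 :=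
  Iff.rfl

lemma evalOnCube_mem (q : MvPolynomial (IndexPair n) ℝ) : evalOnCube n q ∈ algebraicOnCube n :=
  letI := (evalOnCube n).toAlgebra
  isAlgebraic_algebraMap q

lemma inv_evalOnCube_mem (q : MvPolynomial (IndexPair n) ℝ) (hq : ∀ ρ, evalOnCube n q ρ ≠ 0) :
    (evalOnCube n q)⁻¹ ∈ algebraicOnCube n := by
  refine mem_algebraicOnCube.2 ⟨Polynomial.C q * Polynomial.X - 1, fun h => ?_, ?_⟩
  · have := congrArg (Polynomial.eval 0) h
    simp at this
  · ext ρ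
    simp [mul_inv_cancel₀ (hq ρ)]

lemma sqrt_evalOnCube_mem (q : MvPolynomial (IndexPair n) ℝ) (hq : ∀ ρ, 0 ≤ evalOnCube n q ρ) :
    (fun ρ => Real.sqrt (evalOnCube n q ρ)) ∈ algebraicOnCube n := by
  refine mem_algebraicOnCube.2 ⟨Polynomial.X ^ 2 - Polynomial.C q,
    Polynomial.X_pow_sub_C_ne_zero two_pos q, ?_⟩
  ext ρ
  simp [Real.sq_sqrt (hq ρ)]

lemma exists_evalOnCube_eq_param (i j : ℕ) :
    ∃ q, evalOnCube n q = fun ρ => param ρ.1 i j := by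
  by_cases h : i < j ∧ j < n
  · refine ⟨MvPolynomial.X ⟨(⟨i, h.1.trans h.2⟩, ⟨j, h.2⟩), h.1⟩, ?_⟩
    ext ρ
    simp only [param, dif_pos h]
    exact MvPolynomial.eval_X _
  · refine ⟨0, ?_⟩
    ext ρ
    simp only [map_zero, Pi.zero_apply, param, dif_neg h]

lemma exists_evalOnCube_eq_replacedP (I : Finset ℕ) :
    ∃ q, evalOnCube n q = fun ρ => replacedP ρ.1 I := by
  choose q hq using exists_evalOnCube_eq_param (n := n)
  refine ⟨(-1) ^ (I.card / 2) *
    ∏ e ∈ (I ×ˢ I).filter (fun e : ℕ × ℕ => e.1 < e.2), (1 - q e.1 e.2 ^ 2), ?_⟩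
  ext ρ
  simp [replacedP, hq, Finset.prod_apply]

lemma prod_one_sub_param_sq_pos (ρ : openCube n) (s : Finset (ℕ × ℕ)) :
    0 < ∏ e ∈ s, (1 - param ρ.1 e.1 e.2 ^ 2) :=
  Finset.prod_pos fun e _ => sub_pos.2 (param_sq_lt_one ρ.2 e.1 e.2)

lemma inv_replacedP_mem (I : Finset ℕ) :
    (fun ρ : openCube n => (replacedP ρ.1 I)⁻¹) ∈ algebraicOnCube n := by
  obtain ⟨q, hq⟩ := exists_evalOnCube_eq_replacedP (n := n) I
  have := inv_evalOnCube_mem q fun ρ => by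
    rw [hq]
    exact mul_ne_zero (by simp) (prod_one_sub_param_sq_pos ρ _).ne'
  rwa [hq] at this

lemma replacedA_mem (i j : ℕ) :
    (fun ρ : openCube n => replacedA ρ.1 i j) ∈ algebraicOnCube n := by
  obtain ⟨q, hq⟩ := exists_evalOnCube_eq_param (n := n) i j
  obtain ⟨q1, hq1⟩ := exists_evalOnCube_eq_replacedP (n := n) (Finset.Ico i j)
  obtain ⟨q2, hq2⟩ := exists_evalOnCube_eq_replacedP (n := n) (Finset.Ioc i j)
  have h1 := evalOnCube_mem ((-1) ^ (((Finset.Ioo i j).card + 1) / 2) * q)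
  -- The two intervals have equal cardinality, so their signs cancel and the radicand is positive.
  have h2 := sqrt_evalOnCube_mem (q1 * q2) fun ρ => by
    rw [map_mul, hq1, hq2, Pi.mul_apply, replacedP, replacedP, mul_mul_mul_comm, Nat.card_Ico,
      Nat.card_Ioc, neg_one_pow_mul_self, one_mul]
    exact (mul_pos (prod_one_sub_param_sq_pos ρ _) (prod_one_sub_param_sq_pos ρ _)).le
  convert mul_mem h1 h2 using 1
  ext ρ
  simp [replacedA, hq, hq1, hq2]

lemma pathWeight_mem (w : List DyckStep) (l r : ℕ) :
    (fun ρ : openCube n => pathWeight (replacedA ρ.1) (replacedP ρ.1) l r w) ∈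
      algebraicOnCube n := by
  induction w generalizing l r with
  | nil => simp only [pathWeight]; exact one_mem _
  | cons s t ih =>
    rcases s with - | - <;> rcases t with - | ⟨- | -, t⟩
    · simp only [pathWeight]; exact one_mem _
    · simpa only [pathWeight_U_U] using ih l (r + 1)
    · simp only [pathWeight_U_D, div_eq_mul_inv]
      exact mul_mem (mul_mem (replacedA_mem _ _) (inv_replacedP_mem _)) (ih l (r + 1))
    · simp only [pathWeight]; exact one_mem _
    · simp only [pathWeight_D_U, div_eq_mul_inv]
      refine mul_mem (mul_mem (?_ : (fun ρ : openCube n =>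
        if l + 1 = r then 1 else replacedA ρ.1 (l + 1) r) ∈ _) (inv_replacedP_mem _))
        (ih (l + 1) r)
      split_ifs
      · exact one_mem _
      · exact replacedA_mem _ _
    · simpa only [pathWeight_D_D] using ih (l + 1) r

lemma correlationMap_mem (i j : Fin n) :
    (fun ρ : openCube n => correlationMap n ρ.1 i j) ∈ algebraicOnCube n := by
  simp only [correlationMap, Matrix.of_apply]
  split_ifs
  · exact one_mem _
  · simp only [catalanSum]
    have := sum_mem (S := algebraicOnCube n) (t := Finset.univ)
      fun (w : {w : DyckWord // w.semilength = max (i : ℕ) j - min (i : ℕ) j}) _ =>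
        pathWeight_mem (n := n) w.1.toList (min (i : ℕ) j) (min (i : ℕ) j)
    convert this using 1
    ext ρ
    rw [Finset.sum_apply]

lemma exists_polynomial_correlationMap (i j : Fin n) :
    ∃ P : Polynomial (MvPolynomial (IndexPair n) ℝ), P ≠ 0 ∧
      ∀ ρ ∈ openCube n, (P.map (MvPolynomial.eval ρ)).eval (correlationMap n ρ i j) = 0 := by
  obtain ⟨P, hP, h⟩ := mem_algebraicOnCube.1 (correlationMap_mem i j)
  refine ⟨P, hP, fun ρ hρ => ?_⟩
  have h1 := congrArg (Pi.evalRingHom (fun _ : openCube n => ℝ) ⟨ρ, hρ⟩) h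
  rw [Polynomial.hom_eval₂] at h1
  rw [Polynomial.eval_map]
  exact h1

end AlgebraicFunctions

/-! ### Parameter count and conclusion -/

lemma card_indexPair (n : ℕ) : Fintype.card (IndexPair n) = n.choose 2 := by
  rw [Fintype.card_subtype, ← Finset.univ_product_univ, Finset.card_filter, Finset.sum_product]
  simp only [← Finset.card_filter, Finset.filter_lt_eq_Ioi, Fin.card_Ioi]
  rw [Fin.sum_univ_eq_sum_range (fun i => n - 1 - i), Finset.sum_range_reflect (fun i => i),
    Finset.sum_range_id, Nat.choose_two_right]

theorem mainTheorem2 (n : ℕ) :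
    -- there are `n choose 2` parameters
    Fintype.card (IndexPair n) = n.choose 2 ∧
    -- `Ψ` is a bijection from the open cube onto the set of correlation matrices
    Set.BijOn (correlationMap n) (openCube n) (openElliptope n) ∧
    -- every correlation matrix is `Ψ` of its connected partial correlations, and of no other
    -- point of the cube
    (∀ Y ∈ openElliptope n,
      connectedCorrelations Y ∈ openCube n ∧
      correlationMap n (connectedCorrelations Y) = Y ∧
      ∀ ρ ∈ openCube n, correlationMap n ρ = Y → ρ = connectedCorrelations Y) ∧
    -- the parameters are the connected partial correlations of the matrix that they define
    (∀ ρ ∈ openCube n, connectedCorrelations (correlationMap n ρ) = ρ) ∧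
    -- `Ψ` is the only function on the cube that gives the matrix in terms of its connected
    -- partial correlations
    (∀ F : (IndexPair n → ℝ) → Matrix (Fin n) (Fin n) ℝ,
      (∀ Y ∈ openElliptope n, F (connectedCorrelations Y) = Y) →
        Set.EqOn F (correlationMap n) (openCube n)) ∧
    -- the replacements are the values of the connected minors
    (∀ Y ∈ openElliptope n,
      (∀ i j : Fin n, i < j →
        almostPrincipalMinor Y i j (Finset.Ioo i j) =
          replacedA (connectedCorrelations Y) i j) ∧
      (∀ r s : Fin n, r ≤ s →
        principalMinor Y (Finset.Icc r s) =
          replacedP (connectedCorrelations Y) (Finset.Icc (r : ℕ) (s : ℕ)))) ∧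
    -- the entries of `Ψ` are algebraic functions
    (∀ i j : Fin n, ∃ P : Polynomial (MvPolynomial (IndexPair n) ℝ), P ≠ 0 ∧
      ∀ ρ ∈ openCube n,
        (P.map (MvPolynomial.eval ρ)).eval (correlationMap n ρ i j) = 0) := by
  have hY : ∀ Y ∈ openElliptope n, connectedCorrelations Y ∈ openCube n ∧
      correlationMap n (connectedCorrelations Y) = Y := fun Y hY => by
    obtain ⟨v, hv, hone, hYv⟩ := exists_gram_of_mem_openElliptope hY
    exact ⟨hv.connectedCorrelations_mem_openCube hYv,
      (hv.isCorrelationOf hYv).correlationMap_eq hv hone hYv⟩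
  -- Since every point of the cube is ρ(Y) for some Y, the identity Ψ(ρ(Y)) = Y also gives ρ(Ψ(ρ)) =
  -- ρ; no separate injectivity argument is needed.
  have hcube : ∀ ρ ∈ openCube n, correlationMap n ρ ∈ openElliptope n ∧
      connectedCorrelations (correlationMap n ρ) = ρ := fun ρ hρ => by
    obtain ⟨Y, hYE, rfl⟩ := exists_connectedCorrelations_eq hρ
    rw [(hY Y hYE).2]
    exact ⟨hYE, rfl⟩
  refine ⟨card_indexPair n,
    ⟨fun ρ hρ => (hcube ρ hρ).1, fun ρ hρ σ hσ h => ?_, fun Y hYE => ?_⟩,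
    fun Y hYE => ⟨(hY Y hYE).1, (hY Y hYE).2, fun ρ hρ h => ?_⟩, fun ρ hρ => (hcube ρ hρ).2,
    fun F hF ρ hρ => ?_, fun Y hYE => ?_, exists_polynomial_correlationMap⟩
  · rw [← (hcube ρ hρ).2, h, (hcube σ hσ).2]
  · exact ⟨_, (hY Y hYE).1, (hY Y hYE).2⟩
  · rw [← h, (hcube ρ hρ).2]
  · have := hF _ (hcube ρ hρ).1
    rwa [(hcube ρ hρ).2] at this
  · obtain ⟨v, hv, hone, hYv⟩ := exists_gram_of_mem_openElliptope hYE
    have hρ := hv.isCorrelationOf hYv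
    refine ⟨fun i j hij => ?_, fun r s hrs => ?_⟩
    · obtain ⟨m, hm⟩ := Nat.exists_eq_add_of_lt (Fin.lt_def.1 hij)
      rw [(almostPrincipalMinor_eq_gramDet hYv hm).2, hm, hρ.replacedA_eq hv hone (by omega)]
    · obtain ⟨m, hm⟩ := Nat.exists_eq_add_of_le (Fin.le_def.1 hrs)
      have hI : Finset.Icc (r : ℕ) s = Finset.Ico (r : ℕ) (r + (m + 1)) := by
        ext x; rw [Finset.mem_Icc, Finset.mem_Ico]; omega
      rw [principalMinor_eq_gramDet hYv (l := r) (m := m + 1) (by omega) (fun x => by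
        rw [Finset.mem_Icc, Fin.le_def, Fin.le_def]; omega), hI,
        hρ.replacedP_Ico hv hone (by omega)]
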